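/- Let $n\in\mathbb{N}$, let $\sigma>0$, and let $X$ be a random vector in $\mathbb{R}^n$ that is sub-Gaussian with variance proxy $\sigma^2$, i.e. for every $\ell\in\mathbb{R}^n$ with Euclidean norm $\|\ell\|=1$ and every $\lambda\in\mathbb{R}$, $$\mathbb{E}\,e^{\lambda\langle \ell,X\rangle}\le e^{\lambda^2\sigma^2/2}.$$ Then for every $\delta\in(0,1)$, $$\mathbb{P}\Bigl(\|X\|\le \sigma\bigl(\sqrt{n}+\sqrt{2\log(1/\delta)}\bigr)\Bigr)\ge 1-\delta,$$ where $\|\cdot\|$ is the Euclidean norm. -/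

import Mathlib

open scoped NNReal

/-- A random vector `X` in `ℝⁿ` is sub-Gaussian with variance proxy `v` if for every unit vector `ℓ`
the real random variable `⟨ℓ, X⟩` is sub-Gaussian with variance proxy `v`, that is,
`E exp (t ⟨ℓ, X⟩) ≤ exp (v t² / 2)` for all real `t` (the expectations being finite). -/
def IsSubGaussianVector {Ω : Type*} [MeasurableSpace Ω] {n : ℕ}
    (X : Ω → EuclideanSpace ℝ (Fin n)) (v : ℝ≥0) (μ : MeasureTheory.Measure Ω) : Prop :=
  ∀ ℓ : EuclideanSpace ℝ (Fin n), ‖ℓ‖ = 1 →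
    ProbabilityTheory.HasSubgaussianMGF (fun ω => inner ℝ ℓ (X ω)) v μ

open MeasureTheory ProbabilityTheory

/-! A Gaussian integral linearizes the square: `exp (‖x‖² / (4b))` is, up to a constant, `∫ exp
(-b‖v‖² + ⟨x, v⟩) dv`. Put `x = X`, take expectations, swap by Tonelli and bound `E exp ⟨X, v⟩` by
`exp (c‖v‖² / 2)`. What remains is a Gaussian integral with `b - c/2` in place of `b`, so `E exp
(‖X‖² / (4b)) ≤ (b / (b - c/2)) ^ (n/2)`. Markov's inequality with the best `b`, followed by `1 + x
≤ exp x`, gives the tail. -/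

/-- The Gaussian integral with a linear term, in real form. -/
theorem integrable_rexp_neg_mul_sq_norm_add_inner {V : Type*} [NormedAddCommGroup V]
    [InnerProductSpace ℝ V] [FiniteDimensional ℝ V] [MeasurableSpace V] [BorelSpace V]
    {b : ℝ} (hb : 0 < b) (w : V) :
    Integrable (fun v : V => Real.exp (-b * ‖v‖ ^ 2 + inner ℝ w v)) := by
  have h := (GaussianFourier.integrable_cexp_neg_mul_sq_norm_add
    (show 0 < (b : ℂ).re from hb) 1 w).re
  refine h.congr (ae_of_all _ fun v => ?_)
  have : -(b : ℂ) * (‖v‖ : ℂ) ^ 2 + 1 * ((inner ℝ w v : ℝ) : ℂ)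
      = ((-b * ‖v‖ ^ 2 + inner ℝ w v : ℝ) : ℂ) := by push_cast; ring
  simp only [this, ← Complex.ofReal_exp]
  exact Complex.ofReal_re _

theorem integral_rexp_neg_mul_sq_norm_add_inner {V : Type*} [NormedAddCommGroup V]
    [InnerProductSpace ℝ V] [FiniteDimensional ℝ V] [MeasurableSpace V] [BorelSpace V]
    {b : ℝ} (hb : 0 < b) (w : V) :
    ∫ v : V, Real.exp (-b * ‖v‖ ^ 2 + inner ℝ w v) =
      (Real.pi / b) ^ (Module.finrank ℝ V / 2 : ℝ) * Real.exp (‖w‖ ^ 2 / (4 * b)) := by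
  have h := GaussianFourier.integral_cexp_neg_mul_sq_norm_add
    (show 0 < (b : ℂ).re from hb) 1 w
  have hv : ∀ v : V, Complex.exp (-(b : ℂ) * (‖v‖ : ℂ) ^ 2 + 1 * ((inner ℝ w v : ℝ) : ℂ))
      = ((Real.exp (-b * ‖v‖ ^ 2 + inner ℝ w v) : ℝ) : ℂ) := fun v => by
    push_cast; rw [one_mul]
  simp only [hv] at h
  rw [integral_complex_ofReal] at h
  apply Complex.ofReal_injective
  rw [h, Complex.ofReal_mul, Complex.ofReal_cpow (by positivity)]
  push_cast
  simp

/-- In `[0, ∞]` Tonelli needs only measurability, so finiteness of `E exp (‖X‖² / (4b))` comes out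
as a conclusion. -/
theorem lintegral_rexp_neg_mul_sq_norm_add_inner {V : Type*} [NormedAddCommGroup V]
    [InnerProductSpace ℝ V] [FiniteDimensional ℝ V] [MeasurableSpace V] [BorelSpace V]
    {b : ℝ} (hb : 0 < b) (w : V) :
    ∫⁻ v : V, ENNReal.ofReal (Real.exp (-b * ‖v‖ ^ 2 + inner ℝ w v)) =
      ENNReal.ofReal ((Real.pi / b) ^ (Module.finrank ℝ V / 2 : ℝ)) *
        ENNReal.ofReal (Real.exp (‖w‖ ^ 2 / (4 * b))) := by
  rw [← ofReal_integral_eq_lintegral_ofReal (integrable_rexp_neg_mul_sq_norm_add_inner hb w)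
    (ae_of_all _ fun _ => (Real.exp_pos _).le), integral_rexp_neg_mul_sq_norm_add_inner hb w,
    ENNReal.ofReal_mul (by positivity)]

/-- Exponential moments of all linear functionals of a sub-Gaussian vector. -/
theorem IsSubGaussianVector.lintegral_exp_inner_le {Ω : Type*} [MeasurableSpace Ω] {μ : Measure Ω}
    [IsProbabilityMeasure μ] {n : ℕ} {X : Ω → EuclideanSpace ℝ (Fin n)} {c : ℝ≥0}
    (h : IsSubGaussianVector X c μ) (v : EuclideanSpace ℝ (Fin n)) :
    ∫⁻ ω, ENNReal.ofReal (Real.exp (inner ℝ (X ω) v)) ∂μ ≤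
      ENNReal.ofReal (Real.exp (c * ‖v‖ ^ 2 / 2)) := by
  rcases eq_or_ne v 0 with rfl | hv
  · simp
  have hv' : ‖v‖ ≠ 0 := norm_ne_zero_iff.mpr hv
  have hl := h (‖v‖⁻¹ • v) (by simp [norm_smul, hv'])
  have hi : ∀ ω, inner ℝ (X ω) v = ‖v‖ * inner ℝ (‖v‖⁻¹ • v) (X ω) := fun ω => by
    rw [real_inner_smul_left, real_inner_comm, mul_inv_cancel_left₀ hv']
  simp only [hi]
  rw [← ofReal_integral_eq_lintegral_ofReal (hl.integrable_exp_mul _)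
    (ae_of_all _ fun _ => (Real.exp_pos _).le)]
  exact ENNReal.ofReal_le_ofReal (hl.mgf_le _)

/-- The squared norm of a sub-Gaussian vector has the exponential moments of a scaled chi-squared
variable. -/
theorem IsSubGaussianVector.lintegral_exp_sq_norm_le {Ω : Type*} [MeasurableSpace Ω]
    {μ : Measure Ω} [IsProbabilityMeasure μ] {n : ℕ} {X : Ω → EuclideanSpace ℝ (Fin n)} {c : ℝ≥0}
    (h : IsSubGaussianVector X c μ) (hX : AEMeasurable X μ) {b : ℝ} (hb : (c : ℝ) / 2 < b) :
    ∫⁻ ω, ENNReal.ofReal (Real.exp (‖X ω‖ ^ 2 / (4 * b))) ∂μ ≤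
      ENNReal.ofReal ((b / (b - c / 2)) ^ (n / 2 : ℝ)) := by
  have hb0 : 0 < b := lt_of_le_of_lt (by positivity) hb
  have hd : 0 < b - c / 2 := sub_pos.mpr hb
  have hK : 0 < (Real.pi / b) ^ (n / 2 : ℝ) := by positivity
  have hG : ∀ ω, ∫⁻ v, ENNReal.ofReal (Real.exp (-b * ‖v‖ ^ 2 + inner ℝ (X ω) v)) =
      ENNReal.ofReal ((Real.pi / b) ^ (n / 2 : ℝ)) *
        ENNReal.ofReal (Real.exp (‖X ω‖ ^ 2 / (4 * b))) := fun ω => by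
    simpa using lintegral_rexp_neg_mul_sq_norm_add_inner hb0 (X ω)
  have hS : ∫⁻ v : EuclideanSpace ℝ (Fin n),
      ENNReal.ofReal (Real.exp (-(b - c / 2) * ‖v‖ ^ 2)) =
      ENNReal.ofReal ((Real.pi / (b - c / 2)) ^ (n / 2 : ℝ)) := by
    simpa using lintegral_rexp_neg_mul_sq_norm_add_inner hd (0 : EuclideanSpace ℝ (Fin n))
  have hmeas : AEMeasurable (fun p : Ω × EuclideanSpace ℝ (Fin n) =>
      ENNReal.ofReal (Real.exp (-b * ‖p.2‖ ^ 2 + inner ℝ (X p.1) p.2))) (μ.prod volume) := by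
    have hX1 : AEMeasurable (fun p : Ω × EuclideanSpace ℝ (Fin n) => X p.1) (μ.prod volume) :=
      hX.comp_fst
    have h2 : AEMeasurable (fun p : Ω × EuclideanSpace ℝ (Fin n) => p.2) (μ.prod volume) :=
      measurable_snd.aemeasurable
    exact (Real.measurable_exp.comp_aemeasurable
      (((h2.norm.pow_const 2).const_mul (-b)).add (hX1.inner h2))).ennreal_ofReal
  have key : ENNReal.ofReal ((Real.pi / b) ^ (n / 2 : ℝ)) *
      ∫⁻ ω, ENNReal.ofReal (Real.exp (‖X ω‖ ^ 2 / (4 * b))) ∂μ ≤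
      ENNReal.ofReal ((Real.pi / (b - c / 2)) ^ (n / 2 : ℝ)) := by
    rw [← lintegral_const_mul' _ _ ENNReal.ofReal_ne_top]
    simp only [← hG]
    -- After the swap `v` is fixed, and it suffices to compare the integrands in `v`.
    rw [lintegral_lintegral_swap hmeas, ← hS]
    refine lintegral_mono fun v => ?_
    have hfac : ∀ ω, ENNReal.ofReal (Real.exp (-b * ‖v‖ ^ 2 + inner ℝ (X ω) v)) =
        ENNReal.ofReal (Real.exp (-b * ‖v‖ ^ 2)) *
          ENNReal.ofReal (Real.exp (inner ℝ (X ω) v)) := fun ω => by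
      rw [Real.exp_add, ENNReal.ofReal_mul (Real.exp_pos _).le]
    simp only [hfac]
    rw [lintegral_const_mul' _ _ ENNReal.ofReal_ne_top]
    refine (mul_le_mul_right (h.lintegral_exp_inner_le v) _).trans_eq ?_
    rw [← ENNReal.ofReal_mul (Real.exp_pos _).le, ← Real.exp_add]
    congr 2
    ring
  have hsplit : (Real.pi / (b - c / 2)) ^ (n / 2 : ℝ) =
      (Real.pi / b) ^ (n / 2 : ℝ) * (b / (b - c / 2)) ^ (n / 2 : ℝ) := by
    rw [← Real.mul_rpow (by positivity) (by positivity)]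
    congr 1
    field_simp
  rw [hsplit, ENNReal.ofReal_mul hK.le] at key
  exact (ENNReal.mul_le_mul_iff_right (by simpa using hK) ENNReal.ofReal_ne_top).mp key

/-- Chernoff bound for the norm of a sub-Gaussian vector. -/
theorem IsSubGaussianVector.measureReal_lt_norm_le {Ω : Type*} [MeasurableSpace Ω]
    {μ : Measure Ω} [IsProbabilityMeasure μ] {n : ℕ} {X : Ω → EuclideanSpace ℝ (Fin n)} {c : ℝ≥0}
    (h : IsSubGaussianVector X c μ) (hX : AEMeasurable X μ) {b : ℝ} (hb : (c : ℝ) / 2 < b)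
    {s : ℝ} (hs : 0 ≤ s) :
    μ.real {ω | s < ‖X ω‖} ≤
      Real.exp (-(s ^ 2 / (4 * b))) * (b / (b - c / 2)) ^ (n / 2 : ℝ) := by
  have hb0 : 0 < b := lt_of_le_of_lt (by positivity) hb
  have hd : 0 < b - c / 2 := sub_pos.mpr hb
  have hf : AEMeasurable (fun ω => ENNReal.ofReal (Real.exp (‖X ω‖ ^ 2 / (4 * b)))) μ :=
    (Real.measurable_exp.comp_aemeasurable
      ((hX.norm.pow_const 2).div_const (4 * b))).ennreal_ofReal
  have hM := (mul_meas_ge_le_lintegral₀ hf (ENNReal.ofReal (Real.exp (s ^ 2 / (4 * b))))).trans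
    (h.lintegral_exp_sq_norm_le hX hb)
  have hsub : {ω | s < ‖X ω‖} ⊆ {ω | ENNReal.ofReal (Real.exp (s ^ 2 / (4 * b))) ≤
      ENNReal.ofReal (Real.exp (‖X ω‖ ^ 2 / (4 * b)))} := fun ω hω => by
    have hω' : s ≤ ‖X ω‖ := le_of_lt hω
    refine ENNReal.ofReal_le_ofReal (Real.exp_le_exp.mpr ?_)
    gcongr
  have hM' := (mul_le_mul_right (measure_mono (μ := μ) hsub) _).trans hM
  have hr := ENNReal.toReal_mono ENNReal.ofReal_ne_top hM'
  rw [ENNReal.toReal_mul, ENNReal.toReal_ofReal (Real.exp_pos _).le,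
    ENNReal.toReal_ofReal (by positivity)] at hr
  rw [Real.exp_neg, inv_mul_eq_div, le_div_iff₀ (Real.exp_pos _), mul_comm]
  exact hr

theorem mainTheorem2 {Ω : Type*} [MeasurableSpace Ω] (μ : MeasureTheory.Measure Ω)
    [MeasureTheory.IsProbabilityMeasure μ] (n : ℕ) (X : Ω → EuclideanSpace ℝ (Fin n))
    (hX : AEMeasurable X μ) (σ : ℝ≥0) (hσ : 0 < σ) (hsub : IsSubGaussianVector X (σ ^ 2) μ)
    (δ : ℝ) (hδ0 : 0 < δ) (hδ1 : δ < 1) :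
    1 - δ ≤ μ.real {ω | ‖X ω‖ ≤ (σ : ℝ) * (√(n : ℝ) + √(2 * Real.log (1 / δ)))} := by
  -- For `n = 0` the `b` chosen below would equal `σ² / 2`, which the Chernoff bound excludes.
  rcases Nat.eq_zero_or_pos n with rfl | hn
  · have hz : ∀ ω, ‖X ω‖ = 0 := fun ω => by rw [Subsingleton.elim (X ω) 0, norm_zero]
    have huniv : {ω | ‖X ω‖ ≤ (σ : ℝ) * (√((0 : ℕ) : ℝ) + √(2 * Real.log (1 / δ)))} =
        Set.univ := Set.eq_univ_of_forall fun ω => by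
      rw [Set.mem_ofPred_eq, hz]; positivity
    rw [huniv, probReal_univ]
    linarith
  have hlog : 0 < Real.log (1 / δ) := Real.log_pos (by rwa [lt_div_iff₀ hδ0, one_mul])
  set t := √(2 * Real.log (1 / δ)) with ht
  set m := √(n : ℝ) with hm
  have hσ' : (0 : ℝ) < σ := hσ
  have ht0 : 0 < t := Real.sqrt_pos.mpr (by positivity)
  have hm0 : 0 < m := Real.sqrt_pos.mpr (by exact_mod_cast hn)
  have ht2 : t ^ 2 = 2 * Real.log (1 / δ) := Real.sq_sqrt (by positivity)
  have hm2 : (n : ℝ) = m ^ 2 := (Real.sq_sqrt (by positivity)).symm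
  have hq : 0 < (m + t) ^ 2 - m ^ 2 := by nlinarith [mul_pos hm0 ht0]
  -- This `b` minimizes the Chernoff bound at `s = σ (m + t)`: the stationarity condition is `b / (b
  -- - σ²/2) = s² / (n σ²)`.
  set b : ℝ := (σ : ℝ) ^ 2 * (m + t) ^ 2 / (2 * ((m + t) ^ 2 - m ^ 2)) with hb
  have hbsub : b - (σ : ℝ) ^ 2 / 2 = (σ : ℝ) ^ 2 * m ^ 2 / (2 * ((m + t) ^ 2 - m ^ 2)) := by
    rw [hb]; field_simp; ring
  have hbpos : 0 < b - (σ : ℝ) ^ 2 / 2 := by rw [hbsub]; positivity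
  have hratio : b / (b - (σ : ℝ) ^ 2 / 2) = ((m + t) / m) ^ 2 := by
    rw [hbsub, hb]; field_simp
  have hexp : ((σ : ℝ) * (m + t)) ^ 2 / (4 * b) = m * t + t ^ 2 / 2 := by
    rw [hb]; field_simp; ring
  -- The left side is `(1 + t/m) ^ n` with `n = m²`; its bound `exp (m t)` cancels the cross term of
  -- `hexp`, leaving `exp (-t²/2) = δ`.
  have hpow : (((m + t) / m) ^ 2) ^ (n / 2 : ℝ) ≤ Real.exp (m * t) := by
    have h1 : (m + t) / m ≤ Real.exp (t / m) := by
      have := Real.add_one_le_exp (t / m)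
      rwa [add_div, div_self hm0.ne', add_comm]
    calc (((m + t) / m) ^ 2) ^ (n / 2 : ℝ) ≤ (Real.exp (t / m) ^ 2) ^ (n / 2 : ℝ) := by gcongr
      _ = Real.exp (m * t) := by
        rw [← Real.exp_nat_mul, ← Real.exp_mul, hm2]
        congr 1
        push_cast
        field_simp
  have hC := hsub.measureReal_lt_norm_le hX (b := b) (by push_cast; linarith)
    (s := (σ : ℝ) * (m + t)) (by positivity)
  have htail : μ.real {ω | (σ : ℝ) * (m + t) < ‖X ω‖} ≤ δ := by
    push_cast at hC
    rw [hratio, hexp] at hC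
    refine hC.trans ?_
    calc _ ≤ Real.exp (-(m * t + t ^ 2 / 2)) * Real.exp (m * t) := by gcongr
      _ = Real.exp (-Real.log (1 / δ)) := by rw [← Real.exp_add, ht2]; congr 1; ring
      _ = δ := by rw [one_div, Real.log_inv, neg_neg, Real.exp_log hδ0]
  -- Subadditivity replaces the complement rule, since `X` is only a.e. measurable and the event
  -- need not be measurable.
  have hcover := measureReal_union_le (μ := μ) {ω | ‖X ω‖ ≤ (σ : ℝ) * (m + t)}
    {ω | (σ : ℝ) * (m + t) < ‖X ω‖}
  have huniv : {ω | ‖X ω‖ ≤ (σ : ℝ) * (m + t)} ∪ {ω | (σ : ℝ) * (m + t) < ‖X ω‖} = Set.univ :=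
    Set.eq_univ_of_forall fun ω => by simpa using le_or_gt ‖X ω‖ ((σ : ℝ) * (m + t))
  rw [huniv, probReal_univ] at hcover
  linarith
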